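/- Let $n\ge 3$ and $0\le p\le n-2$ be integers, and let $(M^{2n},g,J)$ be a Kaehler manifold of real dimension $2n$, that is, a smooth Riemannian manifold with a smooth almost complex structure $J$ that is orthogonal and parallel with respect to the Levi-Civita connection. Suppose that the holomorphic sectional curvature of $M$ is positive at some point, that is, there is $x\in M$ such that the sectional curvature satisfies $K(X,JX)>0$ for every nonzero $X\in T_xM$. Then there is no (smooth) isometric immersion of $M^{2n}$ into the hyperbolic space $\mathbb{H}^{2n+p}$ of constant sectional curvature $-1$. -/

import Mathlib

open scoped Manifold ContDiff Bundle
open Bundle (RiemannianBundle)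

noncomputable section

/-! ### Riemannian geometry in local coordinates -/

namespace LocalMetric

variable {E : Type*} [NormedAddCommGroup E] [NormedSpace ℝ E]

/-- The covector `w ↦ (1/2) (∂_u g(v,w) + ∂_v g(u,w) - ∂_w g(u,v))` at the point `y`, for constant
vector fields `u, v, w` (Christoffel symbols of the first kind). -/
def christoffelLower (g : E → E →L[ℝ] E →L[ℝ] ℝ) (y u v : E) : E →L[ℝ] ℝ :=
  (1 / 2 : ℝ) • (fderiv ℝ g y u v + fderiv ℝ g y v u - ((fderiv ℝ g y).flip u).flip v)

/-- The Christoffel symbols `Γ(u,v) = ∇_u v` (for constant vector fields `u, v`) of the Levi-Civita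
connection of `g` at `y`: the vector determined by
`g(Γ(u,v), w) = (1/2) (∂_u g(v,w) + ∂_v g(u,w) - ∂_w g(u,v))` for all `w`.
Here `(g y).inverse` is the inverse of the isomorphism `z ↦ g_y(z, ·)` from `E` to its dual. -/
def christoffel (g : E → E →L[ℝ] E →L[ℝ] ℝ) (y u v : E) : E :=
  (g y).inverse (christoffelLower g y u v)

/-- The curvature tensor `R(u,v)w = ∇_u ∇_v w - ∇_v ∇_u w` (for constant vector fields `u, v, w`,
so that `[u,v] = 0`) of the Levi-Civita connection of `g` at `y`. -/
def curvature (g : E → E →L[ℝ] E →L[ℝ] ℝ) (y u v w : E) : E :=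
  fderiv ℝ (fun z ↦ christoffel g z v w) y u - fderiv ℝ (fun z ↦ christoffel g z u w) y v
    + christoffel g y u (christoffel g y v w) - christoffel g y v (christoffel g y u w)

/-- The sectional curvature of `g` at `y` of the plane spanned by `u` and `v`. -/
def sectionalCurvature (g : E → E →L[ℝ] E →L[ℝ] ℝ) (y u v : E) : ℝ :=
  g y (curvature g y u v v) u / (g y u u * g y v v - g y u v ^ 2)

/-- The covariant derivative `(∇_u A) v = ∇_u (A v) - A (∇_u v)` at `y` of a field `A` of
endomorphisms, with respect to the Levi-Civita connection of `g`; `u` and `v` are constant vector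
fields. -/
def covDerivEnd (g : E → E →L[ℝ] E →L[ℝ] ℝ) (A : E → E →L[ℝ] E) (y u v : E) : E :=
  fderiv ℝ A y u v + christoffel g y u (A y v) - A y (christoffel g y u v)

end LocalMetric

/-! ### Riemannian manifolds and Kaehler manifolds -/

section Manifold

variable {E : Type*} [NormedAddCommGroup E] [NormedSpace ℝ E]
  {M : Type*} [TopologicalSpace M] [ChartedSpace E M]

/-- The expression, in the chart around `c`, of the Riemannian metric of `M`. -/
def metricInChart [RiemannianBundle (fun x : M ↦ TangentSpace 𝓘(ℝ, E) x)]
    (c : M) (y : E) : E →L[ℝ] E →L[ℝ] ℝ :=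
  (innerSL ℝ (E := TangentSpace 𝓘(ℝ, E) ((extChartAt 𝓘(ℝ, E) c).symm y))).bilinearComp
    (mfderiv 𝓘(ℝ, E) 𝓘(ℝ, E) (extChartAt 𝓘(ℝ, E) c).symm y)
    (mfderiv 𝓘(ℝ, E) 𝓘(ℝ, E) (extChartAt 𝓘(ℝ, E) c).symm y)

/-- The expression, in the chart around `c`, of a field of endomorphisms of the tangent bundle. -/
def endInChart (J : ∀ x : M, TangentSpace 𝓘(ℝ, E) x →L[ℝ] TangentSpace 𝓘(ℝ, E) x)
    (c : M) (y : E) : E →L[ℝ] E :=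
  (mfderiv 𝓘(ℝ, E) 𝓘(ℝ, E) (extChartAt 𝓘(ℝ, E) c) ((extChartAt 𝓘(ℝ, E) c).symm y)).comp
    ((J ((extChartAt 𝓘(ℝ, E) c).symm y)).comp
      (mfderiv 𝓘(ℝ, E) 𝓘(ℝ, E) (extChartAt 𝓘(ℝ, E) c).symm y))

/-- The sectional curvature of the Riemannian manifold `M` at `x` of the plane spanned by the
tangent vectors `X` and `Y`, computed in the chart around `x`. -/
def sectionalCurvature [RiemannianBundle (fun x : M ↦ TangentSpace 𝓘(ℝ, E) x)]
    (x : M) (X Y : TangentSpace 𝓘(ℝ, E) x) : ℝ :=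
  LocalMetric.sectionalCurvature (metricInChart (E := E) x) (extChartAt 𝓘(ℝ, E) x x)
    (mfderiv 𝓘(ℝ, E) 𝓘(ℝ, E) (extChartAt 𝓘(ℝ, E) x) x X)
    (mfderiv 𝓘(ℝ, E) 𝓘(ℝ, E) (extChartAt 𝓘(ℝ, E) x) x Y)

/-- `J` makes the Riemannian manifold `M` a Kaehler manifold: it is a smooth almost complex
structure which is orthogonal and parallel with respect to the Levi-Civita connection. -/
structure IsKaehler [IsManifold 𝓘(ℝ, E) 1 M]
    [RiemannianBundle (fun x : M ↦ TangentSpace 𝓘(ℝ, E) x)]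
    (J : ∀ x : M, TangentSpace 𝓘(ℝ, E) x →L[ℝ] TangentSpace 𝓘(ℝ, E) x) : Prop where
  smooth : ContMDiff 𝓘(ℝ, E) (𝓘(ℝ, E).prod 𝓘(ℝ, E →L[ℝ] E)) ∞
    (fun x ↦ Bundle.TotalSpace.mk' (E →L[ℝ] E)
      (E := fun x : M ↦ TangentSpace 𝓘(ℝ, E) x →L[ℝ] TangentSpace 𝓘(ℝ, E) x) x (J x))
  sq_eq_neg : ∀ (x : M) (X : TangentSpace 𝓘(ℝ, E) x), J x (J x X) = -X
  orthogonal : ∀ (x : M) (X Y : TangentSpace 𝓘(ℝ, E) x),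
    inner ℝ (J x X) (J x Y) = inner ℝ X Y
  parallel : ∀ c : M, ∀ y ∈ (extChartAt 𝓘(ℝ, E) c).target, ∀ u v : E,
    LocalMetric.covDerivEnd (metricInChart (E := E) c) (endInChart J c) y u v = 0

/-- The holomorphic sectional curvature at `x` is positive: all planes `span {X, J X}`, `X ≠ 0`,
in the tangent space at `x` have positive sectional curvature. -/
def HasPositiveHolomorphicSectionalCurvatureAt
    [RiemannianBundle (fun x : M ↦ TangentSpace 𝓘(ℝ, E) x)]
    (J : ∀ x : M, TangentSpace 𝓘(ℝ, E) x →L[ℝ] TangentSpace 𝓘(ℝ, E) x) (x : M) : Prop :=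
  ∀ X : TangentSpace 𝓘(ℝ, E) x, X ≠ 0 → 0 < sectionalCurvature x X (J x X)

end Manifold

/-! ### Hyperbolic space -/

/-- The underlying vector space `ℝ × ℝ^N` of the Lorentz space of dimension `N + 1`. -/
abbrev LorentzSpace (N : ℕ) : Type := ℝ × EuclideanSpace ℝ (Fin N)

/-- The Lorentz inner product `⟨(s,x), (t,y)⟩ = -st + x₁y₁ + ⋯ + x_N y_N`. -/
def lorentzInner {N : ℕ} (a b : LorentzSpace N) : ℝ :=
  -(a.1 * b.1) + inner ℝ a.2 b.2

/-- Hyperbolic space of dimension `N` and sectional curvature `-1`: the upper sheet of the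
hyperboloid `⟨a, a⟩ = -1` in Lorentz space. -/
def HyperbolicSpace (N : ℕ) : Type :=
  {a : LorentzSpace N // lorentzInner a a = -1 ∧ 0 < a.1}

/-- The inclusion of hyperbolic space into Lorentz space. -/
def HyperbolicSpace.incl {N : ℕ} (a : HyperbolicSpace N) : LorentzSpace N := a.1

/-- Isometric immersions of a Riemannian manifold `M` into hyperbolic space. As hyperbolic space is
an embedded submanifold of Lorentz space, with the metric induced by the Lorentz inner product, these
are the maps `f` into hyperbolic space that are smooth as maps into Lorentz space and whose
differential pulls the Lorentz inner product back to the Riemannian metric of `M`. -/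
structure IsIsometricImmersion (E : Type*) [NormedAddCommGroup E] [NormedSpace ℝ E]
    {M : Type*} [TopologicalSpace M] [ChartedSpace E M]
    [RiemannianBundle (fun x : M ↦ TangentSpace 𝓘(ℝ, E) x)]
    {N : ℕ} (f : M → HyperbolicSpace N) : Prop where
  smooth : ContMDiff 𝓘(ℝ, E) 𝓘(ℝ, LorentzSpace N) ∞ (fun x ↦ (f x).incl)
  isometric : ∀ (x : M) (X Y : TangentSpace 𝓘(ℝ, E) x),
    lorentzInner (N := N) (mfderiv 𝓘(ℝ, E) 𝓘(ℝ, LorentzSpace N) (fun x ↦ (f x).incl) x X)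
      (mfderiv 𝓘(ℝ, E) 𝓘(ℝ, LorentzSpace N) (fun x ↦ (f x).incl) x Y) = inner ℝ X Y

end

/-!
Hyperbolic space lies in Lorentz space, so an isometric immersion `f` of a Kaehler manifold of real
dimension `2n` has a second fundamental form `α` with values in the normal space `W` of its tangent
space in Lorentz space. The form on Lorentz space is positive definite on the tangent space, so `W`
has dimension `p + 1` and at most one timelike direction.

The curvature tensor commutes with the parallel structure `J` (`curvature_apply_of_parallel`) and is
given by `α` through the Gauss equation (`gauss_equation`). Together these say that the bilinear map
`γ(X, Y) = (α(X, Y), α(X, J Y))` into `W × W` is flat for the form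
`⟨⟨(ξ, η), (ξ', η')⟩⟩ = ⟨ξ, ξ'⟩ - ⟨η, η'⟩`, that is,
`⟨⟨γ(X, T), γ(Y, Z)⟩⟩ = ⟨⟨γ(X, Z), γ(Y, T)⟩⟩`.

Choose `X` such that `γ(X, ·)` has maximal rank. Its kernel `K` is `J`-invariant, and it is nonzero,
as `2 (p + 1) < 2n`. By maximality `γ(Y, K)` lies in the range of `γ(X, ·)` for every `Y`, and
flatness then makes all these vectors isotropic and mutually orthogonal (`exists_isotropic_of_flat`).
For `0 ≠ Z ∈ K` and `a = α(Z, Z)`, `c = α(Z, J Z)`, `d = α(J Z, J Z)` this reads `⟨a, a⟩ = ⟨c, c⟩`,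
`⟨a, c⟩ = 0` and `⟨a, d⟩ = -⟨c, c⟩`. If the holomorphic sectional curvature were positive, then
`⟨a, d⟩ - ⟨c, c⟩ > 0`, so `⟨c, c⟩ < 0` and `a`, `c` would be orthogonal timelike vectors, which do not
exist in Lorentz space (`exists_holomorphic_curvature_nonpos`).

All of this takes place at one point, in the chart around it.
-/

/-! ### Flat bilinear maps -/

section FlatBilinear

variable {V U : Type*} [AddCommGroup V] [Module ℝ V] [FiniteDimensional ℝ V]
  [AddCommGroup U] [Module ℝ U] [FiniteDimensional ℝ U]

/-- If the linear map `γ X` has maximal rank among the maps `γ Y`, then every `γ Y` maps the kernel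
of `γ X` into the range of `γ X`. Indeed, if `γ Y Z` were outside this range for some `Z` with
`γ X Z = 0`, then for small `t ≠ 0` the rank of `γ (X + t Y)` would exceed that of `γ X`. -/
theorem exists_apply_mem_range_of_apply_eq_zero (γ : V →ₗ[ℝ] V →ₗ[ℝ] U) :
    ∃ X : V, ∀ Y Z : V, γ X Z = 0 → γ Y Z ∈ LinearMap.range (γ X) := by
  classical
  have hbdd : ∃ X : V, ∀ Y : V, Module.finrank ℝ (LinearMap.range (γ Y)) ≤
      Module.finrank ℝ (LinearMap.range (γ X)) := by
    have hfin : (Set.range fun X : V ↦ Module.finrank ℝ (LinearMap.range (γ X))).Finite :=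
      (Set.finite_Iic (Module.finrank ℝ U)).subset (by
        rintro _ ⟨X, rfl⟩
        exact Submodule.finrank_le _)
    obtain ⟨_, ⟨X, rfl⟩, hX⟩ := hfin.exists_maximal (Set.range_nonempty _)
    refine ⟨X, fun Y ↦ ?_⟩
    by_contra! hlt
    exact absurd (hX ⟨Y, rfl⟩ hlt.le) (not_le.mpr hlt)
  obtain ⟨X, hX⟩ := hbdd
  refine ⟨X, fun Y Z hZ ↦ ?_⟩
  by_contra hnot
  set r := Module.finrank ℝ (LinearMap.range (γ X)) with hr
  let b := Module.finBasis ℝ (LinearMap.range (γ X))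
  choose e he using fun i ↦ (b i).2
  -- The vectors `γ Y Z, γ X e₁, …, γ X e_r` are independent, and this is an open condition.
  have hli : LinearIndependent ℝ (Fin.cons (γ Y Z) (fun i ↦ γ X (e i)) : Fin (r + 1) → U) := by
    refine linearIndependent_finCons.mpr ⟨?_, ?_⟩
    · have : (fun i ↦ γ X (e i)) = fun i ↦ ((LinearMap.range (γ X)).subtype (b i)) := by
        funext i; exact he i
      rw [this]
      exact b.linearIndependent.map' _ (Submodule.ker_subtype _)
    · intro hmem
      refine hnot (Submodule.span_le.mpr ?_ hmem)
      rintro _ ⟨i, rfl⟩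
      exact ⟨_, rfl⟩
  let φ : U ≃ₗ[ℝ] (Fin (Module.finrank ℝ U) → ℝ) := (Module.finBasis ℝ U).equivFun
  let c : ℝ → Fin (r + 1) → (Fin (Module.finrank ℝ U) → ℝ) := fun t ↦
    Fin.cons (φ (γ Y Z)) (fun i ↦ φ (γ X (e i)) + t • φ (γ Y (e i)))
  have hc0 : LinearIndependent ℝ (c 0) := by
    have h : c 0 = φ.toLinearMap ∘ (Fin.cons (γ Y Z) (fun i ↦ γ X (e i)) : Fin (r + 1) → U) := by
      funext i
      refine Fin.cases ?_ (fun j ↦ ?_) i <;> simp [c]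
    rw [h]
    exact hli.map' φ.toLinearMap φ.ker
  have hcont : Continuous c := by
    refine continuous_pi fun i ↦ ?_
    refine Fin.cases ?_ (fun j ↦ ?_) i
    · simpa [c] using continuous_const
    · simp only [c, Fin.cons_succ]
      fun_prop
  have hev : ∀ᶠ t in nhds (0 : ℝ), LinearIndependent ℝ (c t) :=
    hcont.continuousAt.eventually (isOpen_setOfPred_linearIndependent.mem_nhds hc0)
  obtain ⟨t, ht, ht0⟩ := ((hev.filter_mono nhdsWithin_le_nhds).and
    (self_mem_nhdsWithin (s := {(0 : ℝ)}ᶜ))).exists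
  have ht0 : t ≠ 0 := ht0
  have hmem : ∀ i, φ.symm (c t i) ∈ LinearMap.range (γ (X + t • Y)) := by
    refine Fin.cases ?_ (fun j ↦ ?_)
    · refine ⟨t⁻¹ • Z, ?_⟩
      simp [c, hZ, smul_smul, ht0]
    · refine ⟨e j, ?_⟩
      simp [c]
  have hli' : LinearIndependent ℝ
      (fun i ↦ (⟨φ.symm (c t i), hmem i⟩ : LinearMap.range (γ (X + t • Y)))) := by
    refine LinearIndependent.of_comp (LinearMap.range (γ (X + t • Y))).subtype ?_
    exact ht.map' φ.symm.toLinearMap φ.symm.ker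
  have h1 := hli'.fintype_card_le_finrank
  have h2 := hX (X + t • Y)
  simp only [Fintype.card_fin] at h1
  omega

/-- A bilinear map `γ` which is flat with respect to a bilinear form `b` maps `V × ker (γ X)` into
an isotropic subspace, for a suitable `X`. -/
theorem exists_isotropic_of_flat (γ : V →ₗ[ℝ] V →ₗ[ℝ] U) (b : U →ₗ[ℝ] U →ₗ[ℝ] ℝ)
    (hflat : ∀ X Y Z T, b (γ X T) (γ Y Z) = b (γ X Z) (γ Y T)) :
    ∃ X : V, ∀ Y Y' Z Z' : V, γ X Z = 0 → γ X Z' = 0 → b (γ Y Z) (γ Y' Z') = 0 := by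
  obtain ⟨X, hX⟩ := exists_apply_mem_range_of_apply_eq_zero γ
  refine ⟨X, fun Y Y' Z Z' hZ hZ' ↦ ?_⟩
  obtain ⟨S, hS⟩ := hX Y Z hZ
  rw [← hS, hflat, hZ', map_zero, LinearMap.zero_apply]

end FlatBilinear

/-! ### Lorentz space -/

section Lorentz

variable {N : ℕ}

/-- Two timelike vectors of Lorentz space are not orthogonal. -/
theorem lorentzInner_ne_zero_of_timelike {a c : LorentzSpace N} (ha : lorentzInner a a < 0)
    (hc : lorentzInner c c < 0) : lorentzInner a c ≠ 0 := by
  intro h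
  simp only [lorentzInner, real_inner_self_eq_norm_sq] at ha hc h
  have h1 : ‖a.2‖ < |a.1| := by
    rw [← abs_norm]; exact sq_lt_sq.mp (by nlinarith)
  have h2 : ‖c.2‖ < |c.1| := by
    rw [← abs_norm]; exact sq_lt_sq.mp (by nlinarith)
  have h3 := abs_real_inner_le_norm a.2 c.2
  have h4 : inner ℝ a.2 c.2 = a.1 * c.1 := by linarith
  rw [h4, abs_mul] at h3
  exact absurd h3 (not_le.mpr (mul_lt_mul'' h1 h2 (norm_nonneg _) (norm_nonneg _)))

/-- The Lorentz inner product as a continuous bilinear form. -/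
noncomputable def lorentzForm (N : ℕ) : LorentzSpace N →L[ℝ] LorentzSpace N →L[ℝ] ℝ :=
  ((innerSL ℝ (E := EuclideanSpace ℝ (Fin N))).bilinearComp (ContinuousLinearMap.snd ℝ ℝ _)
      (ContinuousLinearMap.snd ℝ ℝ _) : LorentzSpace N →L[ℝ] LorentzSpace N →L[ℝ] ℝ) -
    (ContinuousLinearMap.mul ℝ ℝ).bilinearComp (ContinuousLinearMap.fst ℝ ℝ _)
      (ContinuousLinearMap.fst ℝ ℝ _)

theorem lorentzForm_apply (a b : LorentzSpace N) : lorentzForm N a b = lorentzInner a b := by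
  simp [lorentzForm, lorentzInner, sub_eq_neg_add]

theorem lorentzForm_comm (a b : LorentzSpace N) : lorentzForm N a b = lorentzForm N b a := by
  simp only [lorentzForm_apply, lorentzInner, real_inner_comm, mul_comm]

end Lorentz

/-! ### Kaehler curvature tensors and second fundamental forms -/

section Algebraic

variable {V L : Type*} [AddCommGroup V] [Module ℝ V] [AddCommGroup L] [Module ℝ L]

/-- The subspace of the vectors of `L` which are `B`-orthogonal to the range of `D`. -/
def normalSpace (B : L →ₗ[ℝ] L →ₗ[ℝ] ℝ) (D : V →ₗ[ℝ] L) : Submodule ℝ L :=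
  LinearMap.ker ((LinearMap.lcomp ℝ ℝ D).comp B)

theorem mem_normalSpace {B : L →ₗ[ℝ] L →ₗ[ℝ] ℝ} {D : V →ₗ[ℝ] L} {w : L} :
    w ∈ normalSpace B D ↔ ∀ v, B w (D v) = 0 := by
  simp [normalSpace, LinearMap.ext_iff]

theorem finrank_normalSpace [FiniteDimensional ℝ V] [FiniteDimensional ℝ L]
    (B : L →ₗ[ℝ] L →ₗ[ℝ] ℝ) (D : V →ₗ[ℝ] L)
    (hD : ∀ v, v ≠ 0 → 0 < B (D v) (D v)) :
    Module.finrank ℝ (normalSpace B D) + Module.finrank ℝ V = Module.finrank ℝ L := by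
  set T := (LinearMap.lcomp ℝ ℝ D).comp B with hT
  have hinj : Function.Injective (T.comp D) := by
    rw [injective_iff_map_eq_zero]
    intro v hv
    by_contra hne
    have h := LinearMap.congr_fun hv v
    simp only [hT, LinearMap.comp_apply, LinearMap.lcomp_apply, LinearMap.zero_apply] at h
    exact (hD v hne).ne' h
  have hsurj : Function.Surjective T := by
    have h : Function.Surjective (T.comp D) :=
      (LinearMap.injective_iff_surjective_of_finrank_eq_finrank
        (Subspace.dual_finrank_eq (K := ℝ) (V := V)).symm).mp hinj
    exact Function.Surjective.of_comp h
  have h := T.finrank_range_add_finrank_ker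
  rw [LinearMap.range_eq_top.mpr hsurj, finrank_top, Subspace.dual_finrank_eq] at h
  rw [normalSpace, ← hT]
  omega

/-- Let `α` be a symmetric bilinear map with values in the normal space of a spacelike subspace of
Lorentz space, in which the curvature tensor given by the Gauss equation commutes with a complex
structure `J`. If the codimension is less than half the dimension, then some complex line has
nonpositive curvature.

The map `γ(X, Y) = (α(X, Y), α(X, J Y))` is flat for the difference of two copies of the Lorentz
form, so for `Z` in the kernel of a suitable `γ(X, ·)` the vectors `γ(Y, Z)` and `γ(Y, J Z)` span an
isotropic subspace. If the curvature of the complex line through `Z` were positive, then `α(Z, Z)`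
and `α(Z, J Z)` would be orthogonal timelike vectors. -/
theorem exists_holomorphic_curvature_nonpos [FiniteDimensional ℝ V] {N : ℕ}
    (hdim : 2 * (N + 1) < 3 * Module.finrank ℝ V) (J : V →ₗ[ℝ] V) (hJ : ∀ X, J (J X) = -X)
    (D : V →ₗ[ℝ] LorentzSpace N) (hD : ∀ v, v ≠ 0 → 0 < lorentzInner (D v) (D v))
    (α : V →ₗ[ℝ] V →ₗ[ℝ] LorentzSpace N) (hsymm : ∀ X Y, α X Y = α Y X)
    (hnormal : ∀ X Y v, lorentzInner (α X Y) (D v) = 0)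
    (hkaehler : ∀ X Y Z T,
      lorentzInner (α X (J T)) (α Y (J Z)) - lorentzInner (α X (J Z)) (α Y (J T)) =
        lorentzInner (α X T) (α Y Z) - lorentzInner (α X Z) (α Y T)) :
    ∃ Z : V, Z ≠ 0 ∧
      lorentzInner (α Z Z) (α (J Z) (J Z)) ≤ lorentzInner (α Z (J Z)) (α Z (J Z)) := by
  let B : LorentzSpace N →ₗ[ℝ] LorentzSpace N →ₗ[ℝ] ℝ := (lorentzForm N).toLinearMap₁₂
  have hB : ∀ a b, B a b = lorentzInner a b := lorentzForm_apply
  let W := normalSpace B D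
  have hW : Module.finrank ℝ W + Module.finrank ℝ V = N + 1 := by
    rw [finrank_normalSpace B D (fun v hv ↦ by rw [hB]; exact hD v hv)]
    simp [LorentzSpace, add_comm]
  let γ : V →ₗ[ℝ] V →ₗ[ℝ] LorentzSpace N × LorentzSpace N :=
    LinearMap.mk₂ ℝ (fun X Y ↦ (α X Y, α X (J Y))) (by simp) (by simp) (by simp) (by simp)
  have hγ : ∀ X Y, γ X Y = (α X Y, α X (J Y)) := fun X Y ↦ rfl
  let b : (LorentzSpace N × LorentzSpace N) →ₗ[ℝ] (LorentzSpace N × LorentzSpace N) →ₗ[ℝ] ℝ :=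
    B.compl₁₂ (LinearMap.fst ℝ _ _) (LinearMap.fst ℝ _ _) -
      B.compl₁₂ (LinearMap.snd ℝ _ _) (LinearMap.snd ℝ _ _)
  have hb : ∀ a c, b a c = lorentzInner a.1 c.1 - lorentzInner a.2 c.2 := fun a c ↦ by
    simp [b, hB]
  obtain ⟨X, hX⟩ := exists_isotropic_of_flat γ b fun X Y Z T ↦ by
    simp only [hb, hγ]
    linarith [hkaehler X Y Z T]
  -- `γ X` maps `V` to `W × W`, whose dimension `2 (N + 1 - dim V)` is less than `dim V`.
  have hker : LinearMap.ker (γ X) ≠ ⊥ := by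
    intro hbot
    have hα : ∀ Y, α X Y ∈ W := fun Y ↦ mem_normalSpace.mpr fun v ↦ by rw [hB]; exact hnormal _ _ _
    let T : V →ₗ[ℝ] W × W := ((α X).codRestrict W hα).prod
      ((α X ∘ₗ J).codRestrict W fun Y ↦ hα (J Y))
    have hT : Function.Injective T := by
      refine LinearMap.ker_eq_bot.mp (eq_bot_iff.mpr fun Y hY ↦ ?_)
      have h1 := congrArg Subtype.val (Prod.mk.inj (LinearMap.mem_ker.mp hY)).1
      have h2 := congrArg Subtype.val (Prod.mk.inj (LinearMap.mem_ker.mp hY)).2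
      rw [← hbot, LinearMap.mem_ker, hγ]
      exact Prod.ext h1 h2
    have h := LinearMap.finrank_le_finrank_of_injective hT
    rw [Module.finrank_prod] at h
    omega
  obtain ⟨Z, hZker, hZ⟩ := Submodule.exists_mem_ne_zero_of_ne_bot hker
  have hZ1 : γ X Z = 0 := hZker
  have hZ2 : γ X (J Z) = 0 := by
    have h1 := (Prod.mk.inj hZ1).1
    have h2 := (Prod.mk.inj hZ1).2
    simp [hγ, hJ, h1, h2]
  refine ⟨Z, hZ, ?_⟩
  by_contra! hpos
  have comm : ∀ a c : LorentzSpace N, lorentzInner a c = lorentzInner c a := fun a c ↦ by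
    rw [← lorentzForm_apply, lorentzForm_comm, lorentzForm_apply]
  have neg : ∀ a c : LorentzSpace N, lorentzInner a (-c) = -lorentzInner a c := fun a c ↦ by
    rw [← lorentzForm_apply, map_neg, lorentzForm_apply]
  -- With `a = α(Z, Z)`, `c = α(Z, J Z)`, `d = α(J Z, J Z)`, isotropy gives `⟨a, a⟩ = ⟨c, c⟩`,
  -- `⟨a, c⟩ = 0` and `⟨a, d⟩ = -⟨c, c⟩`, so that `⟨a, d⟩ > ⟨c, c⟩` makes `c` and `a` timelike.
  have e1 := hX Z Z Z Z hZ1 hZ1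
  have e2 := hX Z Z Z (J Z) hZ1 hZ2
  have e3 := hX Z (J Z) Z (J Z) hZ1 hZ2
  simp only [hb, hγ, hJ, map_neg, neg] at e1 e2 e3
  rw [hsymm (J Z) Z] at e3
  rw [comm (α Z (J Z)) (α Z Z)] at e2
  have hc : lorentzInner (α Z (J Z)) (α Z (J Z)) < 0 := by linarith
  exact lorentzInner_ne_zero_of_timelike (a := α Z Z) (by linarith) hc (by linarith)

end Algebraic

/-! ### Curvature of a metric in local coordinates -/

namespace LocalMetric

variable {E : Type*} [NormedAddCommGroup E] [NormedSpace ℝ E]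
  {g : E → E →L[ℝ] E →L[ℝ] ℝ} {s : Set E} {y : E}

/-- The linear map `v ↦ Γ(u, v)`. -/
noncomputable def christoffelMap (g : E → E →L[ℝ] E →L[ℝ] ℝ) (y u : E) : E →L[ℝ] E :=
  (g y).inverse.comp ((1 / 2 : ℝ) • (fderiv ℝ g y u + (fderiv ℝ g y).flip u -
    ((fderiv ℝ g y).flip u).flip))

theorem christoffelMap_apply (g : E → E →L[ℝ] E →L[ℝ] ℝ) (y u v : E) :
    christoffelMap g y u v = christoffel g y u v := rfl

theorem fderiv_fderiv_comm {L : Type*} [NormedAddCommGroup L] [NormedSpace ℝ L]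
    {F : E → L} (hs : IsOpen s) (hF : ContDiffOn ℝ ∞ F s) (hy : y ∈ s)
    (u v : E) :
    fderiv ℝ (fderiv ℝ F) y u v = fderiv ℝ (fderiv ℝ F) y v u :=
  (hF.contDiffAt (hs.mem_nhds hy)).isSymmSndFDerivAt
    (by simpa using (by norm_cast : (2 : WithTop ℕ∞) ≤ ∞)) u v

variable [FiniteDimensional ℝ E]

theorem isInvertible_of_pos {b : E →L[ℝ] E →L[ℝ] ℝ} (hb : ∀ v, v ≠ 0 → 0 < b v v) :
    b.IsInvertible := by
  have hinj : Function.Injective b.toLinearMap := by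
    refine (injective_iff_map_eq_zero b.toLinearMap).mpr fun v hv ↦ ?_
    by_contra hne
    have h : b v v = 0 := congrArg (fun T : E →L[ℝ] ℝ ↦ T v) hv
    exact (hb v hne).ne' h
  have hdim : Module.finrank ℝ E = Module.finrank ℝ (E →L[ℝ] ℝ) := by
    rw [← (LinearMap.toContinuousLinearMap (𝕜 := ℝ) (E := E) (F' := ℝ)).finrank_eq]
    exact (Subspace.dual_finrank_eq (K := ℝ) (V := E)).symm
  exact ⟨(b.toLinearMap.linearEquivOfInjective hinj hdim).toContinuousLinearEquiv, by ext; rfl⟩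

set_option maxSynthPendingDepth 3 in
theorem differentiableAt_christoffelMap (hs : IsOpen s) (hg : ContDiffOn ℝ ∞ g s)
    (hinv : ∀ z ∈ s, (g z).IsInvertible) (hy : y ∈ s) (u : E) :
    DifferentiableAt ℝ (fun z ↦ christoffelMap g z u) y := by
  have hgy : ContDiffAt ℝ ∞ g y := hg.contDiffAt (hs.mem_nhds hy)
  have hg' : ContDiffOn ℝ ∞ (fderiv ℝ g) s := hg.fderiv_of_isOpen hs (by simp)
  have hgc : ∀ a b c, ContDiffOn ℝ ∞ (fun z ↦ fderiv ℝ g z a b c) s := fun a b c ↦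
    ((hg'.clm_apply contDiffOn_const).clm_apply contDiffOn_const).clm_apply contDiffOn_const
  have hi : DifferentiableAt ℝ (fun z ↦ (g z).inverse) y :=
    DifferentiableAt.comp y
      (((hinv y hy).contDiffAt_map_inverse (n := 1)).differentiableAt one_ne_zero)
      (hgy.differentiableAt (by simp))
  have hlower : ContDiffOn ℝ ∞ (fun z ↦ (1 / 2 : ℝ) • (fderiv ℝ g z u + (fderiv ℝ g z).flip u -
      ((fderiv ℝ g z).flip u).flip)) s := by
    refine contDiffOn_clm_apply.mpr fun b ↦ contDiffOn_clm_apply.mpr fun c ↦ ?_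
    exact contDiffOn_const.mul (((hgc u b c).add (hgc b u c)).sub (hgc c u b))
  exact hi.clm_comp ((hlower.contDiffAt (hs.mem_nhds hy)).differentiableAt (by simp))

theorem curvature_eq_christoffelMap (hs : IsOpen s) (hg : ContDiffOn ℝ ∞ g s)
    (hinv : ∀ z ∈ s, (g z).IsInvertible) (hy : y ∈ s) (u v w : E) :
    curvature g y u v w = (fderiv ℝ (fun z ↦ christoffelMap g z v) y u -
      fderiv ℝ (fun z ↦ christoffelMap g z u) y v +
      (christoffelMap g y u * christoffelMap g y v -
        christoffelMap g y v * christoffelMap g y u)) w := by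
  have h : ∀ a b : E, fderiv ℝ (fun z ↦ christoffel g z a w) y b =
      fderiv ℝ (fun z ↦ christoffelMap g z a) y b w := fun a b ↦ by
    simp_rw [← christoffelMap_apply]
    rw [fderiv_clm_apply (differentiableAt_christoffelMap hs hg hinv hy a)
      (differentiableAt_const w)]
    simp
  rw [curvature, h, h]
  simp only [← christoffelMap_apply, add_apply, sub_apply, mul_apply_eq_comp]
  abel

/-- A parallel field of endomorphisms commutes with the curvature tensor: this is the symmetry of
its second derivative. -/
theorem curvature_apply_of_parallel (hs : IsOpen s) (hg : ContDiffOn ℝ ∞ g s)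
    (hinv : ∀ z ∈ s, (g z).IsInvertible) {A : E → E →L[ℝ] E}
    (hpar : ∀ z ∈ s, ∀ u v, covDerivEnd g A z u v = 0) (hy : y ∈ s) (hA : ContDiffAt ℝ 2 A y)
    (u v w : E) :
    curvature g y u v (A y w) = A y (curvature g y u v w) := by
  have hA1 : DifferentiableAt ℝ A y := hA.differentiableAt two_ne_zero
  have hA2 : DifferentiableAt ℝ (fderiv ℝ A) y :=
    (hA.fderiv_right (m := 1) (by norm_num)).differentiableAt one_ne_zero
  have hfirst : ∀ z ∈ s, ∀ a, fderiv ℝ A z a =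
      A z * christoffelMap g z a - christoffelMap g z a * A z := by
    intro z hz a
    ext b
    have := hpar z hz a b
    simp only [covDerivEnd, ← christoffelMap_apply] at this
    simp only [sub_apply, mul_apply_eq_comp]
    rw [← sub_eq_zero, ← this]
    abel
  have hsecond : ∀ a b, fderiv ℝ (fderiv ℝ A) y b a =
      fderiv ℝ A y b * christoffelMap g y a + A y * fderiv ℝ (fun z ↦ christoffelMap g z a) y b -
      (fderiv ℝ (fun z ↦ christoffelMap g z a) y b * A y +
        christoffelMap g y a * fderiv ℝ A y b) := by
    intro a b
    have hG := differentiableAt_christoffelMap hs hg hinv hy a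
    have h1 : HasFDerivAt (fun z ↦ fderiv ℝ A z a) _ y :=
      hA2.hasFDerivAt.clm_apply (hasFDerivAt_const a y)
    have h2 : (fun z ↦ fderiv ℝ A z a) =ᶠ[nhds y]
        fun z ↦ (A z).comp (christoffelMap g z a) - (christoffelMap g z a).comp (A z) :=
      Filter.eventually_of_mem (hs.mem_nhds hy) fun z hz ↦ hfirst z hz a
    have h3 : HasFDerivAt
        (fun z ↦ (A z).comp (christoffelMap g z a) - (christoffelMap g z a).comp (A z)) _ y :=
      (hA1.hasFDerivAt.clm_comp hG.hasFDerivAt).sub (hG.hasFDerivAt.clm_comp hA1.hasFDerivAt)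
    ext c
    have h4 := congrArg (fun T : E →L[ℝ] E →L[ℝ] E ↦ T b c)
      (h1.unique (h3.congr_of_eventuallyEq h2))
    simp only [add_apply, sub_apply, mul_apply_eq_comp, ContinuousLinearMap.comp_apply,
      ContinuousLinearMap.flip_apply, ContinuousLinearMap.compL_apply, zero_apply, map_zero,
      zero_add] at h4 ⊢
    rw [h4]
    abel
  have hsymm : fderiv ℝ (fderiv ℝ A) y u v = fderiv ℝ (fderiv ℝ A) y v u :=
    (hA.isSymmSndFDerivAt (by simp)) u v
  rw [hsecond, hsecond, hfirst y hy, hfirst y hy] at hsymm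
  rw [curvature_eq_christoffelMap hs hg hinv hy, curvature_eq_christoffelMap hs hg hinv hy,
    ← mul_apply_eq_comp, ← mul_apply_eq_comp]
  congr 1
  rw [← sub_eq_zero] at hsymm ⊢
  rw [← neg_eq_zero, ← hsymm]
  noncomm_ring

/-! ### The Gauss equation -/

section Gauss

variable {L : Type*} [NormedAddCommGroup L] [NormedSpace ℝ L] {B : L →L[ℝ] L →L[ℝ] ℝ} {F : E → L}

/-- The second fundamental form `F'' - F'(Γ)` at `y` of a map `F` from a domain with the metric
`g`. -/
noncomputable def secondFundamentalForm (g : E → E →L[ℝ] E →L[ℝ] ℝ) (F : E → L) (y u v : E) : L :=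
  fderiv ℝ (fderiv ℝ F) y u v - fderiv ℝ F y (christoffel g y u v)

theorem contDiffOn_of_eq_pullback (hs : IsOpen s) (hF : ContDiffOn ℝ ∞ F s)
    (hg : ∀ z ∈ s, ∀ u v, g z u v = B (fderiv ℝ F z u) (fderiv ℝ F z v)) :
    ContDiffOn ℝ ∞ g s := by
  have hF' : ContDiffOn ℝ ∞ (fderiv ℝ F) s := hF.fderiv_of_isOpen hs (by simp)
  refine contDiffOn_clm_apply.mpr fun u ↦ contDiffOn_clm_apply.mpr fun v ↦ ?_
  refine ContDiffOn.congr ?_ fun z hz ↦ hg z hz u v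
  exact (contDiffOn_const.clm_apply (hF'.clm_apply contDiffOn_const)).clm_apply
    (hF'.clm_apply contDiffOn_const)

theorem fderiv_eq_pullback (hs : IsOpen s) (hF : ContDiffOn ℝ ∞ F s)
    (hg : ∀ z ∈ s, ∀ u v, g z u v = B (fderiv ℝ F z u) (fderiv ℝ F z v)) (hy : y ∈ s)
    (u v w : E) :
    fderiv ℝ g y u v w = B (fderiv ℝ (fderiv ℝ F) y u v) (fderiv ℝ F y w) +
      B (fderiv ℝ F y v) (fderiv ℝ (fderiv ℝ F) y u w) := by
  have hgy : DifferentiableAt ℝ g y :=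
    ((contDiffOn_of_eq_pullback hs hF hg).contDiffAt (hs.mem_nhds hy)).differentiableAt (by simp)
  have hF' : DifferentiableAt ℝ (fderiv ℝ F) y :=
    ((hF.contDiffAt (hs.mem_nhds hy)).fderiv_right (m := 1) (by norm_cast)).differentiableAt
      one_ne_zero
  have hFa : ∀ a, HasFDerivAt (fun z ↦ fderiv ℝ F z a)
      ((fderiv ℝ (fderiv ℝ F) y).flip a) y := fun a ↦ by
    simpa using hF'.hasFDerivAt.clm_apply (hasFDerivAt_const a y)
  have h1 : HasFDerivAt (fun z ↦ g z v w) (((fderiv ℝ g y).flip v).flip w) y := by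
    have := (hgy.hasFDerivAt.clm_apply (hasFDerivAt_const v y)).clm_apply (hasFDerivAt_const w y)
    simpa using this
  have h2 : HasFDerivAt (fun z ↦ B (fderiv ℝ F z v) (fderiv ℝ F z w)) _ y :=
    B.hasFDerivAt_of_bilinear (hFa v) (hFa w)
  have h3 : (fun z ↦ g z v w) =ᶠ[nhds y] fun z ↦ B (fderiv ℝ F z v) (fderiv ℝ F z w) :=
    Filter.eventually_of_mem (hs.mem_nhds hy) fun z hz ↦ hg z hz v w
  have h4 := congrArg (fun T : E →L[ℝ] ℝ ↦ T u) (h1.unique (h2.congr_of_eventuallyEq h3))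
  simpa [add_comm] using h4

theorem apply_christoffel_of_eq_pullback (hs : IsOpen s) (hF : ContDiffOn ℝ ∞ F s)
    (hB : ∀ a b, B a b = B b a)
    (hg : ∀ z ∈ s, ∀ u v, g z u v = B (fderiv ℝ F z u) (fderiv ℝ F z v))
    (hinv : ∀ z ∈ s, (g z).IsInvertible) (hy : y ∈ s) (u v w : E) :
    g y (christoffel g y u v) w = B (fderiv ℝ (fderiv ℝ F) y u v) (fderiv ℝ F y w) := by
  rw [christoffel, (hinv y hy).self_apply_inverse]
  simp only [christoffelLower, smul_apply, add_apply,
    sub_apply, ContinuousLinearMap.flip_apply, smul_eq_mul,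
    fderiv_eq_pullback hs hF hg hy]
  rw [fderiv_fderiv_comm hs hF hy v u, fderiv_fderiv_comm hs hF hy w u,
    fderiv_fderiv_comm hs hF hy w v, hB (fderiv ℝ F y u), hB (fderiv ℝ F y v)]
  ring

theorem secondFundamentalForm_normal (hs : IsOpen s) (hF : ContDiffOn ℝ ∞ F s)
    (hB : ∀ a b, B a b = B b a)
    (hg : ∀ z ∈ s, ∀ u v, g z u v = B (fderiv ℝ F z u) (fderiv ℝ F z v))
    (hinv : ∀ z ∈ s, (g z).IsInvertible) (hy : y ∈ s) (u v w : E) :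
    B (secondFundamentalForm g F y u v) (fderiv ℝ F y w) = 0 := by
  simp only [secondFundamentalForm, map_sub, sub_apply]
  rw [← hg y hy, apply_christoffel_of_eq_pullback hs hF hB hg hinv hy, sub_self]

theorem secondFundamentalForm_comm (hs : IsOpen s) (hF : ContDiffOn ℝ ∞ F s)
    (hB : ∀ a b, B a b = B b a)
    (hg : ∀ z ∈ s, ∀ u v, g z u v = B (fderiv ℝ F z u) (fderiv ℝ F z v))
    (hinv : ∀ z ∈ s, (g z).IsInvertible) (hy : y ∈ s) (u v : E) :
    secondFundamentalForm g F y u v = secondFundamentalForm g F y v u := by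
  have h : christoffel g y u v = christoffel g y v u := by
    refine (hinv y hy).injective ?_
    ext w
    rw [apply_christoffel_of_eq_pullback hs hF hB hg hinv hy,
      apply_christoffel_of_eq_pullback hs hF hB hg hinv hy, fderiv_fderiv_comm hs hF hy]
  rw [secondFundamentalForm, secondFundamentalForm, h, fderiv_fderiv_comm hs hF hy]

/-- The Gauss equation, for a map `F` into a vector space with a constant symmetric bilinear form
`B` whose pullback is the metric `g`. It is the antisymmetrization in `u, v` of the derivative along
`u` of the identity `g (Γ(v, w), z) = B (F''(v, w), F' z)`. -/
theorem gauss_equation (hs : IsOpen s) (hF : ContDiffOn ℝ ∞ F s)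
    (hB : ∀ a b, B a b = B b a)
    (hg : ∀ z ∈ s, ∀ u v, g z u v = B (fderiv ℝ F z u) (fderiv ℝ F z v))
    (hinv : ∀ z ∈ s, (g z).IsInvertible) (hy : y ∈ s) (u v w z : E) :
    g y (curvature g y u v w) z =
      B (secondFundamentalForm g F y u z) (secondFundamentalForm g F y v w) -
        B (secondFundamentalForm g F y u w) (secondFundamentalForm g F y v z) := by
  have hgs := contDiffOn_of_eq_pullback hs hF hg
  have hgy : DifferentiableAt ℝ g y := (hgs.contDiffAt (hs.mem_nhds hy)).differentiableAt (by simp)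
  have hFy : ContDiffAt ℝ ∞ F y := hF.contDiffAt (hs.mem_nhds hy)
  have hF1 : ContDiffAt ℝ ∞ (fderiv ℝ F) y := hFy.fderiv_right (by simp)
  have hF1' : DifferentiableAt ℝ (fderiv ℝ F) y := hF1.differentiableAt (by simp)
  have hF2 : DifferentiableAt ℝ (fderiv ℝ (fderiv ℝ F)) y :=
    (hF1.fderiv_right (m := 1) (by norm_cast)).differentiableAt one_ne_zero
  have hFsymm : ∀ a b, fderiv ℝ (fderiv ℝ (fderiv ℝ F)) y a b =
      fderiv ℝ (fderiv ℝ (fderiv ℝ F)) y b a := fun a b ↦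
    hF1.isSymmSndFDerivAt (by simpa using (by norm_cast : (2 : WithTop ℕ∞) ≤ ∞)) a b
  have hnorm : ∀ a b c, B (secondFundamentalForm g F y a b) (fderiv ℝ F y c) = 0 :=
    secondFundamentalForm_normal hs hF hB hg hinv hy
  have hderiv : ∀ a b, g y (fderiv ℝ (fun x ↦ christoffel g x b w) y a +
      christoffel g y a (christoffel g y b w)) z =
      B (fderiv ℝ (fderiv ℝ (fderiv ℝ F)) y a b w) (fderiv ℝ F y z) +
        B (secondFundamentalForm g F y b w) (secondFundamentalForm g F y a z) := by
    intro a b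
    have hΓ : DifferentiableAt ℝ (fun x ↦ christoffel g x b w) y :=
      (differentiableAt_christoffelMap hs hgs hinv hy b).clm_apply (differentiableAt_const w)
    have h1 : HasFDerivAt (fun x ↦ g x (christoffel g x b w) z) _ y :=
      (hgy.hasFDerivAt.clm_apply hΓ.hasFDerivAt).clm_apply (hasFDerivAt_const z y)
    have h2 : HasFDerivAt (fun x ↦ fderiv ℝ (fderiv ℝ F) x b w) _ y :=
      (hF2.hasFDerivAt.clm_apply (hasFDerivAt_const b y)).clm_apply (hasFDerivAt_const w y)
    have h3 : HasFDerivAt (fun x ↦ B (fderiv ℝ (fderiv ℝ F) x b w) (fderiv ℝ F x z)) _ y :=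
      B.hasFDerivAt_of_bilinear h2 (hF1'.hasFDerivAt.clm_apply (hasFDerivAt_const z y))
    have h4 : (fun x ↦ g x (christoffel g x b w) z) =ᶠ[nhds y]
        fun x ↦ B (fderiv ℝ (fderiv ℝ F) x b w) (fderiv ℝ F x z) :=
      Filter.eventually_of_mem (hs.mem_nhds hy) fun x hx ↦
        apply_christoffel_of_eq_pullback hs hF hB hg hinv hx b w z
    have h5 := congrArg (fun T : E →L[ℝ] ℝ ↦ T a) (h1.unique (h3.congr_of_eventuallyEq h4))
    simp only [add_apply, ContinuousLinearMap.comp_apply,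
      ContinuousLinearMap.flip_apply, zero_apply, map_zero, zero_add,
      ContinuousLinearMap.precompR_apply, ContinuousLinearMap.precompL_apply,
      ContinuousLinearMap.compL_apply,
      fderiv_eq_pullback hs hF hg hy] at h5
    have h6 := apply_christoffel_of_eq_pullback hs hF hB hg hinv hy a (christoffel g y b w) z
    have h7 := hnorm b w (christoffel g y a z)
    have h8 : B (secondFundamentalForm g F y b w) (secondFundamentalForm g F y a z) =
        B (fderiv ℝ (fderiv ℝ F) y b w) (fderiv ℝ (fderiv ℝ F) y a z) -
        B (fderiv ℝ F y (christoffel g y b w)) (fderiv ℝ (fderiv ℝ F) y a z) := by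
      conv_lhs => rw [secondFundamentalForm.eq_def g F y a z, map_sub, h7, sub_zero,
        secondFundamentalForm, map_sub, sub_apply]
    rw [map_add, add_apply]
    linarith
  have hcurv : curvature g y u v w =
      (fderiv ℝ (fun x ↦ christoffel g x v w) y u + christoffel g y u (christoffel g y v w)) -
      (fderiv ℝ (fun x ↦ christoffel g x u w) y v + christoffel g y v (christoffel g y u w)) := by
    rw [curvature]; abel
  rw [hcurv, map_sub, sub_apply, hderiv, hderiv, hFsymm v u,
    hB (secondFundamentalForm g F y v w)]
  ring

end Gauss

end LocalMetric

/-! ### Riemannian metrics and endomorphism fields in charts -/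

section Charts

variable {E : Type*} [NormedAddCommGroup E] [NormedSpace ℝ E]
  {M : Type*} [TopologicalSpace M] [ChartedSpace E M]

theorem endInChart_apply (J : ∀ x : M, TangentSpace 𝓘(ℝ, E) x →L[ℝ] TangentSpace 𝓘(ℝ, E) x)
    (c : M) (y u : E) :
    endInChart J c y u =
      mfderiv 𝓘(ℝ, E) 𝓘(ℝ, E) (extChartAt 𝓘(ℝ, E) c) ((extChartAt 𝓘(ℝ, E) c).symm y)
        (J _ (mfderiv 𝓘(ℝ, E) 𝓘(ℝ, E) (extChartAt 𝓘(ℝ, E) c).symm y u)) := rfl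

theorem metricInChart_apply [RiemannianBundle (fun x : M ↦ TangentSpace 𝓘(ℝ, E) x)]
    (c : M) (y u v : E) :
    metricInChart c y u v =
      inner ℝ (mfderiv 𝓘(ℝ, E) 𝓘(ℝ, E) (extChartAt 𝓘(ℝ, E) c).symm y u)
        (mfderiv 𝓘(ℝ, E) 𝓘(ℝ, E) (extChartAt 𝓘(ℝ, E) c).symm y v) := rfl

theorem IsIsometricImmersion.contDiffOn_comp_symm [IsManifold 𝓘(ℝ, E) ∞ M]
    [RiemannianBundle (fun x : M ↦ TangentSpace 𝓘(ℝ, E) x)] {N : ℕ} {f : M → HyperbolicSpace N}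
    (hf : IsIsometricImmersion E f) (c : M) :
    ContDiffOn ℝ ∞ (fun y ↦ (f ((extChartAt 𝓘(ℝ, E) c).symm y)).incl)
      (extChartAt 𝓘(ℝ, E) c).target :=
  contMDiffOn_iff_contDiffOn.mp (hf.smooth.comp_contMDiffOn (contMDiffOn_extChartAt_symm c))

variable [IsManifold 𝓘(ℝ, E) 1 M]

theorem mfderiv_extChartAt_mfderiv_symm {c : M} {y : E} (hy : y ∈ (extChartAt 𝓘(ℝ, E) c).target)
    (u : E) :
    mfderiv 𝓘(ℝ, E) 𝓘(ℝ, E) (extChartAt 𝓘(ℝ, E) c) ((extChartAt 𝓘(ℝ, E) c).symm y)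
      (mfderiv 𝓘(ℝ, E) 𝓘(ℝ, E) (extChartAt 𝓘(ℝ, E) c).symm y u) = u := by
  have h := mfderiv_extChartAt_comp_mfderivWithin_extChartAt_symm hy
  rw [ModelWithCorners.range_eq_univ, mfderivWithin_univ] at h
  exact congrArg (fun T : E →L[ℝ] E ↦ T u) h

theorem mfderiv_symm_mfderiv_extChartAt {c : M} {y : E} (hy : y ∈ (extChartAt 𝓘(ℝ, E) c).target)
    (X : TangentSpace 𝓘(ℝ, E) ((extChartAt 𝓘(ℝ, E) c).symm y)) :
    mfderiv 𝓘(ℝ, E) 𝓘(ℝ, E) (extChartAt 𝓘(ℝ, E) c).symm y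
      (mfderiv 𝓘(ℝ, E) 𝓘(ℝ, E) (extChartAt 𝓘(ℝ, E) c) ((extChartAt 𝓘(ℝ, E) c).symm y) X) = X := by
  have h := mfderivWithin_extChartAt_symm_comp_mfderiv_extChartAt hy
  rw [ModelWithCorners.range_eq_univ, mfderivWithin_univ] at h
  exact congrArg (fun T : E →L[ℝ] E ↦ T X) h

variable (J : ∀ x : M, TangentSpace 𝓘(ℝ, E) x →L[ℝ] TangentSpace 𝓘(ℝ, E) x)

theorem mfderiv_symm_endInChart {c : M} {y : E} (hy : y ∈ (extChartAt 𝓘(ℝ, E) c).target) (u : E) :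
    mfderiv 𝓘(ℝ, E) 𝓘(ℝ, E) (extChartAt 𝓘(ℝ, E) c).symm y (endInChart J c y u) =
      J _ (mfderiv 𝓘(ℝ, E) 𝓘(ℝ, E) (extChartAt 𝓘(ℝ, E) c).symm y u) := by
  rw [endInChart_apply, mfderiv_symm_mfderiv_extChartAt hy]

theorem endInChart_mfderiv_extChartAt {c x : M} (hx : x ∈ (extChartAt 𝓘(ℝ, E) c).source)
    (X : TangentSpace 𝓘(ℝ, E) x) :
    endInChart J c (extChartAt 𝓘(ℝ, E) c x) (mfderiv 𝓘(ℝ, E) 𝓘(ℝ, E) (extChartAt 𝓘(ℝ, E) c) x X) =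
      mfderiv 𝓘(ℝ, E) 𝓘(ℝ, E) (extChartAt 𝓘(ℝ, E) c) x (J x X) := by
  obtain ⟨y, hy, rfl⟩ : ∃ y ∈ (extChartAt 𝓘(ℝ, E) c).target, (extChartAt 𝓘(ℝ, E) c).symm y = x :=
    ⟨_, (extChartAt 𝓘(ℝ, E) c).map_source hx, (extChartAt 𝓘(ℝ, E) c).left_inv hx⟩
  rw [(extChartAt 𝓘(ℝ, E) c).right_inv hy]
  exact congrArg (fun Y ↦ mfderiv 𝓘(ℝ, E) 𝓘(ℝ, E) (extChartAt 𝓘(ℝ, E) c) _ (J _ Y))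
    (mfderiv_symm_mfderiv_extChartAt hy X)

variable {J}

/-- The trivialization of the tangent bundle used to define smoothness of sections is the one given
by the chart, so a smooth field of endomorphisms has a smooth expression in the chart. -/
theorem contDiffAt_endInChart [IsManifold 𝓘(ℝ, E) ∞ M]
    (hJ : ContMDiff 𝓘(ℝ, E) (𝓘(ℝ, E).prod 𝓘(ℝ, E →L[ℝ] E)) ∞
      (fun x ↦ Bundle.TotalSpace.mk' (E →L[ℝ] E)
        (E := fun x : M ↦ TangentSpace 𝓘(ℝ, E) x →L[ℝ] TangentSpace 𝓘(ℝ, E) x) x (J x)))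
    (c : M) : ContDiffAt ℝ ∞ (endInChart J c) (extChartAt 𝓘(ℝ, E) c c) := by
  have h1 := ((contMDiffAt_hom_bundle _).mp (hJ c)).2
  have hsymm : ContMDiffAt 𝓘(ℝ, E) 𝓘(ℝ, E) ∞ (extChartAt 𝓘(ℝ, E) c).symm
      (extChartAt 𝓘(ℝ, E) c c) :=
    (contMDiffOn_extChartAt_symm c).contMDiffAt (extChartAt_target_mem_nhds c)
  have h2 := ContMDiffAt.comp_of_eq h1 hsymm (extChartAt_to_inv c)
  refine (contMDiffAt_iff_contDiffAt.mp h2).congr_of_eventuallyEq ?_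
  filter_upwards [extChartAt_target_mem_nhds (I := 𝓘(ℝ, E)) c] with y hy
  have hs : (extChartAt 𝓘(ℝ, E) c).symm y ∈ (chartAt E c).source := by
    rw [← extChartAt_source 𝓘(ℝ, E)]
    exact (extChartAt 𝓘(ℝ, E) c).map_target hy
  simp only [Function.comp_apply, ContinuousLinearMap.inCoordinates]
  rw [TangentBundle.continuousLinearMapAt_trivializationAt hs,
    TangentBundle.symmL_trivializationAt hs, (extChartAt 𝓘(ℝ, E) c).right_inv hy,
    ModelWithCorners.range_eq_univ, mfderivWithin_univ]
  rfl

variable [RiemannianBundle (fun x : M ↦ TangentSpace 𝓘(ℝ, E) x)]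

theorem metricInChart_pos {c : M} {y : E} (hy : y ∈ (extChartAt 𝓘(ℝ, E) c).target) {u : E}
    (hu : u ≠ 0) : 0 < metricInChart c y u u := by
  rw [metricInChart_apply]
  refine real_inner_self_pos.mpr fun h ↦ hu ?_
  rw [← mfderiv_extChartAt_mfderiv_symm hy u, h]
  exact map_zero _

namespace IsKaehler

theorem endInChart_endInChart (hJ : IsKaehler J) {c : M} {y : E}
    (hy : y ∈ (extChartAt 𝓘(ℝ, E) c).target) (u : E) :
    endInChart J c y (endInChart J c y u) = -u := by
  rw [endInChart_apply, mfderiv_symm_endInChart J hy, hJ.sq_eq_neg]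
  exact (map_neg _ _).trans (congrArg Neg.neg (mfderiv_extChartAt_mfderiv_symm hy u))

theorem metricInChart_endInChart (hJ : IsKaehler J) {c : M} {y : E}
    (hy : y ∈ (extChartAt 𝓘(ℝ, E) c).target) (u v : E) :
    metricInChart c y (endInChart J c y u) (endInChart J c y v) = metricInChart c y u v := by
  simp only [metricInChart_apply, mfderiv_symm_endInChart J hy]
  exact hJ.orthogonal _ _ _

end IsKaehler

namespace IsIsometricImmersion

variable {N : ℕ} {f : M → HyperbolicSpace N}

theorem metricInChart_eq (hf : IsIsometricImmersion E f) {c : M} {y : E}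
    (hy : y ∈ (extChartAt 𝓘(ℝ, E) c).target) (u v : E) :
    metricInChart c y u v =
      lorentzForm N (fderiv ℝ (fun z ↦ (f ((extChartAt 𝓘(ℝ, E) c).symm z)).incl) y u)
        (fderiv ℝ (fun z ↦ (f ((extChartAt 𝓘(ℝ, E) c).symm z)).incl) y v) := by
  have hsymm : MDifferentiableAt 𝓘(ℝ, E) 𝓘(ℝ, E) (extChartAt 𝓘(ℝ, E) c).symm y :=
    ((contMDiffOn_extChartAt_symm (n := 1) c).contMDiffAt
      ((isOpen_extChartAt_target c).mem_nhds hy)).mdifferentiableAt one_ne_zero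
  have h : fderiv ℝ (fun z ↦ (f ((extChartAt 𝓘(ℝ, E) c).symm z)).incl) y =
      (mfderiv 𝓘(ℝ, E) 𝓘(ℝ, LorentzSpace N) (fun x ↦ (f x).incl)
        ((extChartAt 𝓘(ℝ, E) c).symm y)).comp
        (mfderiv 𝓘(ℝ, E) 𝓘(ℝ, E) (extChartAt 𝓘(ℝ, E) c).symm y) := by
    rw [← mfderiv_eq_fderiv]
    exact mfderiv_comp y (hf.smooth.mdifferentiable (by simp) _) hsymm
  rw [metricInChart_apply, ← hf.isometric, lorentzForm_apply, h]
  rfl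

end IsIsometricImmersion

end Charts

/-- A Kaehler manifold isometrically immersed in hyperbolic space has a complex line of nonpositive
sectional curvature in each tangent space, if its codimension in Lorentz space is less than half its
dimension. -/
theorem not_hasPositiveHolomorphicSectionalCurvatureAt {E : Type*} [NormedAddCommGroup E]
    [NormedSpace ℝ E] [FiniteDimensional ℝ E] {M : Type*} [TopologicalSpace M] [ChartedSpace E M]
    [IsManifold 𝓘(ℝ, E) ∞ M]
    [RiemannianBundle (fun x : M ↦ TangentSpace 𝓘(ℝ, E) x)]
    {N : ℕ} (hdim : 2 * (N + 1) < 3 * Module.finrank ℝ E)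
    {J : ∀ x : M, TangentSpace 𝓘(ℝ, E) x →L[ℝ] TangentSpace 𝓘(ℝ, E) x} (hJ : IsKaehler J)
    {f : M → HyperbolicSpace N} (hf : IsIsometricImmersion E f) (x : M) :
    ¬ HasPositiveHolomorphicSectionalCurvatureAt J x := by
  intro hpos
  set s := (extChartAt 𝓘(ℝ, E) x).target with hs_def
  set y := extChartAt 𝓘(ℝ, E) x x with hy_def
  set g := metricInChart (E := E) x with hg_def
  set A := endInChart J x with hA_def
  set F : E → LorentzSpace N := fun z ↦ (f ((extChartAt 𝓘(ℝ, E) x).symm z)).incl with hF_def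
  have hs : IsOpen s := isOpen_extChartAt_target x
  have hy : y ∈ s := mem_extChartAt_target x
  have hF : ContDiffOn ℝ ∞ F s := hf.contDiffOn_comp_symm x
  have hg : ∀ z ∈ s, ∀ u v, g z u v = lorentzForm N (fderiv ℝ F z u) (fderiv ℝ F z v) :=
    fun z hz ↦ hf.metricInChart_eq hz
  have hgpos : ∀ z ∈ s, ∀ u, u ≠ 0 → 0 < g z u u := fun z hz u hu ↦ metricInChart_pos hz hu
  have hinv : ∀ z ∈ s, (g z).IsInvertible := fun z hz ↦ LocalMetric.isInvertible_of_pos (hgpos z hz)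
  have hA2 : ∀ u, A y (A y u) = -u := hJ.endInChart_endInChart hy
  have hAg : ∀ u v, g y (A y u) (A y v) = g y u v := hJ.metricInChart_endInChart hy
  have hAR : ∀ u v w, LocalMetric.curvature g y u v (A y w) =
      A y (LocalMetric.curvature g y u v w) :=
    LocalMetric.curvature_apply_of_parallel hs (LocalMetric.contDiffOn_of_eq_pullback hs hF hg) hinv
      (hJ.parallel x) hy ((contDiffAt_endInChart hJ.smooth x).of_le (by norm_cast))
  have hgauss := LocalMetric.gauss_equation hs hF lorentzForm_comm hg hinv hy
  have hsymm := LocalMetric.secondFundamentalForm_comm hs hF lorentzForm_comm hg hinv hy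
  have hnormal := LocalMetric.secondFundamentalForm_normal hs hF lorentzForm_comm hg hinv hy
  have hadd : ∀ u v w, LocalMetric.secondFundamentalForm g F y u (v + w) =
      LocalMetric.secondFundamentalForm g F y u v + LocalMetric.secondFundamentalForm g F y u w :=
    fun u v w ↦ by
      simp only [LocalMetric.secondFundamentalForm, ← LocalMetric.christoffelMap_apply, map_add]
      abel
  have hsmul : ∀ (a : ℝ) u v, LocalMetric.secondFundamentalForm g F y u (a • v) =
      a • LocalMetric.secondFundamentalForm g F y u v := fun a u v ↦ by
    simp only [LocalMetric.secondFundamentalForm, ← LocalMetric.christoffelMap_apply, map_smul,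
      smul_sub]
  let α : E →ₗ[ℝ] E →ₗ[ℝ] LorentzSpace N :=
    LinearMap.mk₂ ℝ (LocalMetric.secondFundamentalForm g F y)
      (fun u v w ↦ by rw [hsymm, hadd, hsymm w u, hsymm w v])
      (fun a u v ↦ by rw [hsymm, hsmul, hsymm v u]) hadd hsmul
  have hα : ∀ u v, α u v = LocalMetric.secondFundamentalForm g F y u v := fun u v ↦ rfl
  have hRm : ∀ u v w z, g y (LocalMetric.curvature g y u v w) z =
      lorentzInner (α u z) (α v w) - lorentzInner (α u w) (α v z) := fun u v w z ↦ by
    rw [hgauss, lorentzForm_apply, lorentzForm_apply]; rfl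
  obtain ⟨Z, hZ, hle⟩ := exists_holomorphic_curvature_nonpos hdim (A y).toLinearMap hA2
    (fderiv ℝ F y).toLinearMap
    (fun v hv ↦ by
      have h := hgpos y hy v hv
      rwa [hg y hy, lorentzForm_apply] at h)
    α (fun u v ↦ hsymm u v)
    (fun u v w ↦ by
      have h := hnormal u v w
      rwa [lorentzForm_apply] at h)
    (fun u v w z ↦ by
      have h := hRm u v (A y w) (A y z)
      rw [hAR, hAg, hRm] at h
      exact h.symm)
  have hx : x ∈ (extChartAt 𝓘(ℝ, E) x).source := mem_extChartAt_source x
  obtain ⟨X, hX⟩ := (isInvertible_mfderiv_extChartAt hx).surjective Z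
  have hX0 : X ≠ 0 := by
    rintro rfl
    exact hZ (hX.symm.trans (map_zero _))
  have hK := hpos X hX0
  rw [sectionalCurvature, ← endInChart_mfderiv_extChartAt J hx, hX,
    LocalMetric.sectionalCurvature] at hK
  have hnum : g y (LocalMetric.curvature g y Z (A y Z) (A y Z)) Z ≤ 0 := by
    rw [hRm]
    have h : α (A y Z) Z = α Z (A y Z) := hsymm _ _
    rw [h]
    exact sub_nonpos.mpr hle
  -- The denominator `|Z|² |JZ|² - ⟨Z, JZ⟩²` is `|Z|⁴`, as `J` is orthogonal with `J² = -1`.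
  have horth : g y Z (A y Z) = 0 := by
    have h1 := hAg Z (A y Z)
    have h2 : g y Z (A y Z) = g y (A y Z) Z := by rw [hg y hy, hg y hy, lorentzForm_comm]
    rw [hA2, map_neg] at h1
    linarith
  have hden : 0 ≤ g y Z Z * g y (A y Z) (A y Z) - g y Z (A y Z) ^ 2 := by
    rw [horth, hAg]
    nlinarith [sq_nonneg (g y Z Z)]
  exact absurd hK (not_lt.mpr (div_nonpos_of_nonpos_of_nonneg hnum hden))

theorem mainTheorem3 (n p : ℕ) (hn : 3 ≤ n) (hp : p + 2 ≤ n)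
    {M : Type*} [TopologicalSpace M] [T2Space M] [SecondCountableTopology M]
    [ChartedSpace (EuclideanSpace ℝ (Fin (2 * n))) M]
    [IsManifold 𝓘(ℝ, EuclideanSpace ℝ (Fin (2 * n))) ∞ M]
    [RiemannianBundle (fun x : M ↦ TangentSpace 𝓘(ℝ, EuclideanSpace ℝ (Fin (2 * n))) x)]
    [IsContMDiffRiemannianBundle 𝓘(ℝ, EuclideanSpace ℝ (Fin (2 * n))) ∞
      (EuclideanSpace ℝ (Fin (2 * n)))
      (fun x : M ↦ TangentSpace 𝓘(ℝ, EuclideanSpace ℝ (Fin (2 * n))) x)]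
    (J : ∀ x : M, TangentSpace 𝓘(ℝ, EuclideanSpace ℝ (Fin (2 * n))) x →L[ℝ]
      TangentSpace 𝓘(ℝ, EuclideanSpace ℝ (Fin (2 * n))) x)
    (hJ : IsKaehler J)
    (hpos : ∃ x : M, HasPositiveHolomorphicSectionalCurvatureAt J x) :
    ¬ ∃ f : M → HyperbolicSpace (2 * n + p), IsIsometricImmersion (EuclideanSpace ℝ (Fin (2 * n))) f := by

  rintro ⟨f, hf⟩
  obtain ⟨x, hx⟩ := hpos
  refine not_hasPositiveHolomorphicSectionalCurvatureAt ?_ hJ hf x hx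
  rw [finrank_euclideanSpace_fin]
  omega
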